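/- **Definitions.** A frame is a complete lattice satisfying $a\wedge\bigvee S=\bigvee\{a\wedge s\mid s\in S\}$; it is *algebraic* if every element is a join of compact elements, and *compact* if its top element is compact. Let $\mathsf{KAlgFrm}$ be the category of compact algebraic frames, with morphisms the maps that preserve arbitrary joins, finite meets, and compact elements. Meet-semilattices have a top element, and homomorphisms of meet-semilattices preserve all finite meets, including the top. A meet-semilattice $M$ is *distributive* if $a\wedge b\le c$ implies that $c=a'\wedge b'$ for some $a'\ge a$, $b'\ge b$; it is *bounded* if it also has a bottom element. Let $\mathsf{BDMS_P}$ be the category of bounded distributive meet-semilattices whose morphisms are the meet-semilattice homomorphisms $\alpha:M_1\to M_2$ such that, for every finite $S\subseteq M_1$ and every upper bound $x$ of $\alpha[S]$, there is an upper bound $c$ of $S$ with $\alpha(c)\le x$. A *prime filter* of $M$ is a proper filter $P$ such that, for all filters $F_1,F_2$ of $M$, $F_1\cap F_2\subseteq P$ implies $F_1\subseteq P$ or $F_2\subseteq P$. Distributive join-semilattices and prime ideals are the order-dual notions. A *Priestley space* is a compact ordered space in which, whenever $x\not\le y$, some clopen upset contains $x$ and misses $y$. Given a subset $X_0$ of a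 Priestley space $X$, a clopen upset $U$ is *admissible* if every maximal element of $X\setminus U$ lies in $X_0$; $\mathcal A(X)$ denotes the set of admissible clopen upsets, and $\mathcal I_x=\{U\in\mathcal A(X)\mid x\notin U\}$. A *generalized Priestley space* is a Priestley space $X$ with a dense subset $X_0$ such that: each $x\in X$ lies below some $y\in X_0$; $x\in X_0$ iff $\mathcal I_x$ is directed under inclusion; and $x\le y$ iff every $U\in\mathcal A(X)$ containing $x$ contains $y$. Let $\mathsf{GPS_P}$ be the category of generalized Priestley spaces whose morphisms $f:X\to Y$ are the order-preserving maps with $f^{-1}(U)\in\mathcal A(X)$ for all $U\in\mathcal A(Y)$ and with $f[X_0]\subseteq Y_0$. **Theorem.** 1. $\mathsf{KAlgFrm}$ is equivalent to $\mathsf{BDMS_P}$. 2. $\mathsf{KAlgFrm}$ is dually equivalent to $\mathsf{GPS_P}$. 3. A meet-semilattice homomorphism $\alpha:M_1\to M_2$ between bounded distributive meet-semilattices is a $\mathsf{BDMS_P}$-morphism if and only if $\alpha^{-1}(P)$ is a prime filter of $M_1$ for every prime filter $P$ of $M_2$. 4. Consequently (Hansoul–Poussart duality), the category of bounded distributive join-semilattices,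 with morphisms the maps that preserve finite joins (including the bottom) and pull prime ideals back to prime ideals, is dually equivalent to $\mathsf{GPS_P}$. -/

import Mathlib

open CategoryTheory

universe u

/-! ### Compact algebraic frames -/

/-- A compact algebraic frame: a frame in which every element is a join of compact elements and
whose top element is compact. -/
structure KAlgFrm : Type (u + 1) where
  carrier : Type u
  [frame : Order.Frame carrier]
  [algebraic : IsCompactlyGenerated carrier]
  isCompactElement_top : IsCompactElement (⊤ : carrier)

namespace KAlgFrm

instance : CoeSort KAlgFrm.{u} (Type u) := ⟨KAlgFrm.carrier⟩

attribute [instance] KAlgFrm.frame KAlgFrm.algebraic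

/-- Morphisms: maps preserving arbitrary joins, finite meets, and compact elements. -/
@[ext]
structure Hom (L M : KAlgFrm.{u}) : Type u where
  toFrameHom : FrameHom L M
  map_isCompactElement : ∀ k : L, IsCompactElement k → IsCompactElement (toFrameHom k)

instance : Category KAlgFrm.{u} where
  Hom := Hom
  id L := ⟨FrameHom.id L, fun _ hk => hk⟩
  comp f g := ⟨g.toFrameHom.comp f.toFrameHom,
    fun k hk => g.map_isCompactElement _ (f.map_isCompactElement k hk)⟩

end KAlgFrm

/-! ### Bounded distributive meet-semilattices -/

/-- Distributivity of a meet-semilattice. -/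
def IsDistribMeetSemilattice (M : Type u) [SemilatticeInf M] : Prop :=
  ∀ a b c : M, a ⊓ b ≤ c → ∃ a' b' : M, a ≤ a' ∧ b ≤ b' ∧ a' ⊓ b' = c

/-- A prime filter of a meet-semilattice: a proper filter `P` such that `F ∩ G ⊆ P` implies
`F ⊆ P` or `G ⊆ P` for all filters `F`, `G`. -/
structure IsPrimeFilter {M : Type u} [SemilatticeInf M] (P : Set M) : Prop where
  isPFilter : Order.IsPFilter P
  ne_univ : P ≠ Set.univ
  subset_or_subset : ∀ F G : Set M, Order.IsPFilter F → Order.IsPFilter G →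
    F ∩ G ⊆ P → F ⊆ P ∨ G ⊆ P

/-- The condition defining `P`-morphisms: whenever `S` is finite and `x` is an upper bound of the
image of `S`, there is an upper bound `c` of `S` with `α c ≤ x`. -/
def LiftsUpperBounds {M N : Type u} [Preorder M] [Preorder N] (α : M → N) : Prop :=
  ∀ S : Set M, S.Finite → ∀ x ∈ upperBounds (α '' S), ∃ c ∈ upperBounds S, α c ≤ x

/-- A bounded distributive meet-semilattice. -/
structure BDMSP : Type (u + 1) where
  carrier : Type u
  [semilatticeInf : SemilatticeInf carrier]
  [boundedOrder : BoundedOrder carrier]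
  distrib : IsDistribMeetSemilattice carrier

namespace BDMSP

instance : CoeSort BDMSP.{u} (Type u) := ⟨BDMSP.carrier⟩

attribute [instance] BDMSP.semilatticeInf BDMSP.boundedOrder

/-- Morphisms: maps preserving finite meets (including the top element) and satisfying
`LiftsUpperBounds`. -/
@[ext]
structure Hom (M N : BDMSP.{u}) : Type u where
  toInfTopHom : InfTopHom M N
  liftsUpperBounds : LiftsUpperBounds toInfTopHom

instance : Category BDMSP.{u} where
  Hom := Hom
  id M := ⟨InfTopHom.id M, fun S _ x hx => ⟨x, fun s hs => hx ⟨s, hs, rfl⟩, le_rfl⟩⟩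
  comp {M N K} f g := ⟨g.toInfTopHom.comp f.toInfTopHom, fun S hS x hx => by
    obtain ⟨d, hd, hdx⟩ := g.liftsUpperBounds (f.toInfTopHom '' S) (hS.image _) x (by
      rintro _ ⟨_, ⟨s, hs, rfl⟩, rfl⟩
      exact hx ⟨s, hs, rfl⟩)
    obtain ⟨c, hc, hcd⟩ := f.liftsUpperBounds S hS d hd
    exact ⟨c, hc, (OrderHomClass.mono g.toInfTopHom hcd).trans hdx⟩⟩

end BDMSP

/-! ### Bounded distributive join-semilattices -/

/-- Distributivity of a join-semilattice. -/
def IsDistribJoinSemilattice (J : Type u) [SemilatticeSup J] : Prop :=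
  ∀ a b c : J, c ≤ a ⊔ b → ∃ a' b' : J, a' ≤ a ∧ b' ≤ b ∧ a' ⊔ b' = c

/-- A prime ideal of a join-semilattice: a proper ideal `P` such that `I ∩ J ⊆ P` implies
`I ⊆ P` or `J ⊆ P` for all ideals `I`, `J`. -/
structure IsPrimeIdealOfSup {J : Type u} [SemilatticeSup J] (P : Set J) : Prop where
  isIdeal : Order.IsIdeal P
  ne_univ : P ≠ Set.univ
  subset_or_subset : ∀ F G : Set J, Order.IsIdeal F → Order.IsIdeal G →
    F ∩ G ⊆ P → F ⊆ P ∨ G ⊆ P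

/-- A bounded distributive join-semilattice. -/
structure BDJS : Type (u + 1) where
  carrier : Type u
  [semilatticeSup : SemilatticeSup carrier]
  [boundedOrder : BoundedOrder carrier]
  distrib : IsDistribJoinSemilattice carrier

namespace BDJS

instance : CoeSort BDJS.{u} (Type u) := ⟨BDJS.carrier⟩

attribute [instance] BDJS.semilatticeSup BDJS.boundedOrder

/-- Morphisms: maps preserving finite joins (including the bottom element) under which the inverse
image of every prime ideal is a prime ideal. -/
@[ext]
structure Hom (J K : BDJS.{u}) : Type u where
  toSupBotHom : SupBotHom J K
  isPrimeIdeal_preimage : ∀ P : Set K, IsPrimeIdealOfSup P → IsPrimeIdealOfSup (toSupBotHom ⁻¹' P)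

instance : Category BDJS.{u} where
  Hom := Hom
  id J := ⟨SupBotHom.id J, fun _ hP => hP⟩
  comp f g := ⟨g.toSupBotHom.comp f.toSupBotHom,
    fun P hP => f.isPrimeIdeal_preimage _ (g.isPrimeIdeal_preimage P hP)⟩

end BDJS

/-! ### Generalized Priestley spaces -/

/-- Relative to a subset `X₀` of an ordered topological space, a clopen upset `U` is admissible
if all maximal elements of its complement lie in `X₀`. -/
structure IsAdmissible {X : Type u} [TopologicalSpace X] [PartialOrder X] (X₀ U : Set X) :
    Prop where
  isClopen : IsClopen U
  isUpperSet : IsUpperSet U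
  maximal_mem : ∀ x, Maximal (· ∈ Uᶜ) x → x ∈ X₀

/-- A generalized Priestley space. (In Mathlib, `PriestleySpace` is only the separation axiom.) -/
structure GPSP : Type (u + 1) where
  carrier : Type u
  [topologicalSpace : TopologicalSpace carrier]
  [partialOrder : PartialOrder carrier]
  [compactSpace : CompactSpace carrier]
  [priestleySpace : PriestleySpace carrier]
  /-- The distinguished subset `X₀`. -/
  core : Set carrier
  dense_core : Dense core
  exists_le_core : ∀ x, ∃ y ∈ core, x ≤ y
  mem_core_iff : ∀ x, x ∈ core ↔ DirectedOn (· ⊆ ·) {U | IsAdmissible core U ∧ x ∉ U}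
  le_iff : ∀ x y, x ≤ y ↔ ∀ U, IsAdmissible core U → x ∈ U → y ∈ U

namespace GPSP

instance : CoeSort GPSP.{u} (Type u) := ⟨GPSP.carrier⟩

attribute [instance] GPSP.topologicalSpace GPSP.partialOrder GPSP.compactSpace GPSP.priestleySpace

/-- Morphisms: strong Priestley morphisms (order-preserving maps under which the inverse image of
every admissible clopen upset is an admissible clopen upset) that map `X₀` into `Y₀`. -/
@[ext]
structure Hom (X Y : GPSP.{u}) : Type u where
  toOrderHom : X →o Y
  isAdmissible_preimage : ∀ U : Set Y, IsAdmissible Y.core U →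
    IsAdmissible X.core (toOrderHom ⁻¹' U)
  map_core : ∀ x ∈ X.core, toOrderHom x ∈ Y.core

instance : Category GPSP.{u} where
  Hom := Hom
  id X := ⟨OrderHom.id, fun _ hU => hU, fun _ hx => hx⟩
  comp f g := ⟨g.toOrderHom.comp f.toOrderHom,
    fun U hU => f.isAdmissible_preimage _ (g.isAdmissible_preimage U hU),
    fun x hx => g.map_core _ (f.map_core x hx)⟩

end GPSP

/-! ### Prime filters of meet-semilattices -/

section PrimeFilter

variable {M N : Type u} [SemilatticeInf M] [SemilatticeInf N]

/-! Three functors, each fully faithful and essentially surjective, land in bounded distributive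
meet-semilattices.

Frames: a compact algebraic frame is determined by its compact elements, which form a
join-semilattice; reversed, this is the meet-semilattice, and the frame returns as its ideals. A
finite meet of compact elements need not be compact, so a frame morphism restricted to compacts only
remembers meets approximately: a compact element below finitely many `f s` lies below `f c` for a
compact lower bound `c`. Read in the reverse order this is `LiftsUpperBounds`, and it is exactly
what makes the join-extension of a map of compacts preserve finite meets (`extendFun_inf`,
`extendFun_top`).

Prime filters: a filter is prime iff its complement is nonempty and directed, and distributivity
supplies enough of them (`exists_isPrimeFilter`). Lifting upper bounds is then the same as pulling
prime filters back to prime filters, so dualizing the order identifies the join-semilattice category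
with the meet-semilattice one.

Spaces: the prime filters need not be closed in `M → Bool`. The optimal filters form a closed set in
which they are dense, and serve as the points of the dual space with the primes as its core.
Compactness, with maximal points of complements of admissible sets lying in the core, reduces
statements about admissible sets to core points (`exists_finset_inf_le`), where the sets missing a
point are directed. -/

theorem isPFilter_iff [OrderTop M] {P : Set M} :
    Order.IsPFilter P ↔ IsUpperSet P ∧ ⊤ ∈ P ∧ ∀ a ∈ P, ∀ b ∈ P, a ⊓ b ∈ P := by
  constructor
  · intro h
    have hup : IsUpperSet P := fun a b hab ha => h.IsLowerSet hab ha
    refine ⟨hup, ?_, fun a ha b hb => ?_⟩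
    · obtain ⟨x, hx⟩ := h.Nonempty
      exact hup (le_top (a := OrderDual.ofDual x)) hx
    · obtain ⟨c, hc, hca, hcb⟩ := h.Directed a ha b hb
      exact hup (le_inf hca hcb) hc
  · rintro ⟨hup, htop, hinf⟩
    exact Order.IsPFilter.of_def ⟨⊤, htop⟩
      (fun a ha b hb => ⟨a ⊓ b, hinf a ha b hb, inf_le_left, inf_le_right⟩) (fun h ha => hup h ha)

theorem isPFilter_Ici [OrderTop M] (a : M) : Order.IsPFilter (Set.Ici a) :=
  isPFilter_iff.2 ⟨isUpperSet_Ici a, le_top, fun _ hb _ hc => le_inf hb hc⟩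

theorem DirectedOn.exists_mem_upperBounds {α : Type*} [Preorder α] {D S : Set α}
    (hD : DirectedOn (· ≤ ·) D) (hne : D.Nonempty) (hS : S.Finite) (hSD : S ⊆ D) :
    ∃ c ∈ D, c ∈ upperBounds S := by
  induction S, hS using Set.Finite.induction_on with
  | empty => exact ⟨hne.some, hne.some_mem, by simp⟩
  | @insert a S _ _ ih =>
    obtain ⟨c, hc, hcS⟩ := ih fun s hs => hSD (Set.mem_insert_of_mem _ hs)
    obtain ⟨d, hd, had, hcd⟩ := hD a (hSD (Set.mem_insert _ _)) c hc
    refine ⟨d, hd, ?_⟩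
    rintro s (rfl | hs)
    · exact had
    · exact (hcS hs).trans hcd

/-- A filter is prime if and only if its complement is nonempty and directed. -/
theorem isPrimeFilter_iff [OrderTop M] {P : Set M} :
    IsPrimeFilter P ↔ Order.IsPFilter P ∧ Pᶜ.Nonempty ∧ DirectedOn (· ≤ ·) Pᶜ := by
  constructor
  · intro h
    refine ⟨h.isPFilter, Set.nonempty_compl.2 h.ne_univ, fun a ha b hb => ?_⟩
    by_contra! hc
    -- If `a` and `b` had no common upper bound outside `P`, the intersection of their principal
    -- filters would lie in `P`.
    rcases h.subset_or_subset _ _ (isPFilter_Ici a) (isPFilter_Ici b) fun c hc' => by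
      by_contra hcP
      exact hc c hcP hc'.1 hc'.2 with h' | h'
    · exact ha (h' le_rfl)
    · exact hb (h' le_rfl)
  · rintro ⟨hP, hne, hdir⟩
    refine ⟨hP, Set.nonempty_compl.1 hne, fun F G hF hG hFG => ?_⟩
    by_contra! h
    obtain ⟨a, haF, haP⟩ := Set.not_subset.1 h.1
    obtain ⟨b, hbG, hbP⟩ := Set.not_subset.1 h.2
    obtain ⟨c, hc, hac, hbc⟩ := hdir a haP b hbP
    exact hc (hFG ⟨(isPFilter_iff.1 hF).1 hac haF, (isPFilter_iff.1 hG).1 hbc hbG⟩)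

/-- The prime filter theorem for distributive meet-semilattices. -/
theorem exists_isPrimeFilter [OrderTop M] (hM : IsDistribMeetSemilattice M) {F : Set M}
    (hF : Order.IsPFilter F) {x : M} (hx : x ∉ F) :
    ∃ P, IsPrimeFilter P ∧ F ⊆ P ∧ x ∉ P := by
  obtain ⟨P, hFP, hP⟩ := zorn_subset_nonempty {G : Set M | Order.IsPFilter G ∧ x ∉ G}
    (fun c hc hchain hne => by
      refine ⟨⋃₀ c, ⟨isPFilter_iff.2 ⟨?_, ?_, ?_⟩, ?_⟩, fun s hs => Set.subset_sUnion_of_mem hs⟩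
      · exact isUpperSet_sUnion fun s hs => (isPFilter_iff.1 (hc hs).1).1
      · exact ⟨hne.some, hne.some_mem, (isPFilter_iff.1 (hc hne.some_mem).1).2.1⟩
      · rintro a ⟨s, hs, ha⟩ b ⟨t, ht, hb⟩
        rcases hchain.total hs ht with h | h
        · exact ⟨t, ht, (isPFilter_iff.1 (hc ht).1).2.2 a (h ha) b hb⟩
        · exact ⟨s, hs, (isPFilter_iff.1 (hc hs).1).2.2 a ha b (h hb)⟩
      · rintro ⟨s, hs, hxs⟩
        exact (hc hs).2 hxs) F ⟨hF, hx⟩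
  obtain ⟨hup, htop, hinf⟩ := isPFilter_iff.1 hP.prop.1
  have hxP : x ∉ P := hP.prop.2
  have key : ∀ a, a ∉ P → ∃ p ∈ P, p ⊓ a ≤ x := by
    intro a ha
    by_contra! h
    have hG : Order.IsPFilter {y : M | ∃ p ∈ P, p ⊓ a ≤ y} := by
      refine isPFilter_iff.2 ⟨?_, ⟨⊤, htop, le_top⟩, ?_⟩
      · rintro y z hyz ⟨p, hp, hpy⟩
        exact ⟨p, hp, hpy.trans hyz⟩
      · rintro y ⟨p, hp, hpy⟩ z ⟨q, hq, hqz⟩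
        exact ⟨p ⊓ q, hinf p hp q hq, le_inf
          ((inf_le_inf_right a inf_le_left).trans hpy) ((inf_le_inf_right a inf_le_right).trans hqz)⟩
    exact ha (hP.le_of_ge ⟨hG, fun ⟨p, hp, hpx⟩ => h p hp hpx⟩
      (fun p hp => ⟨p, hp, inf_le_left⟩) ⟨⊤, htop, inf_le_right⟩)
  refine ⟨P, isPrimeFilter_iff.2 ⟨hP.prop.1, ⟨x, hxP⟩, fun a ha b hb => ?_⟩, hFP, hxP⟩
  obtain ⟨p, hp, hpa⟩ := key a ha
  obtain ⟨q, hq, hqb⟩ := key b hb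
  -- Distributivity is applied twice: `x = p' ⊓ a'`, and since `q ⊓ b ≤ x ≤ a'`, also `a' = q' ⊓
  -- b'`. Then `b'` lies above both `a` and `b`, and `b' ∈ P` would force `x ∈ P`.
  obtain ⟨p', a', hpp', haa', rfl⟩ := hM p a x hpa
  obtain ⟨q', b', hqq', hbb', rfl⟩ := hM q b a' (hqb.trans inf_le_right)
  exact ⟨b', fun hb' => hxP (hinf _ (hup hpp' hp) _ (hinf _ (hup hqq' hq) _ hb')),
    haa'.trans inf_le_right, hbb'⟩

theorem exists_isPrimeFilter_of_not_le [OrderTop M] (hM : IsDistribMeetSemilattice M) {a b : M}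
    (hab : ¬a ≤ b) : ∃ P, IsPrimeFilter P ∧ a ∈ P ∧ b ∉ P := by
  obtain ⟨P, hP, hF, hb⟩ := exists_isPrimeFilter hM (isPFilter_Ici a) hab
  exact ⟨P, hP, hF le_rfl, hb⟩

/-- Upper bounds of finite sets outside `P` can be chosen outside `P`; lifting them makes the
complement of the preimage nonempty (empty set) and directed (pairs). Conversely, if lifting fails
for `S` and `x`, a prime filter containing `α c` for all upper bounds `c` of `S` but missing `x` has
a preimage that misses `S` yet contains every upper bound of `S`, so it is not prime. -/
theorem liftsUpperBounds_iff_isPrimeFilter_preimage [BoundedOrder M] [BoundedOrder N]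
    (hN : IsDistribMeetSemilattice N) (α : InfTopHom M N) :
    LiftsUpperBounds α ↔ ∀ P : Set N, IsPrimeFilter P → IsPrimeFilter (α ⁻¹' P) := by
  have hmono : Monotone α := OrderHomClass.mono α
  constructor
  · intro hα P hP
    obtain ⟨hPF, hne, hdir⟩ := isPrimeFilter_iff.1 hP
    obtain ⟨hup, htop, hinf⟩ := isPFilter_iff.1 hPF
    have hlift : ∀ S : Set M, S.Finite → S ⊆ (α ⁻¹' P)ᶜ → ∃ c ∈ upperBounds S, α c ∉ P := by
      intro S hS hSP
      obtain ⟨x, hx, hxS⟩ := hdir.exists_mem_upperBounds hne (hS.image α) (by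
        rintro _ ⟨s, hs, rfl⟩
        exact hSP hs)
      obtain ⟨c, hc, hcx⟩ := hα S hS x hxS
      exact ⟨c, hc, fun h => hx (hup hcx h)⟩
    refine isPrimeFilter_iff.2 ⟨isPFilter_iff.2 ⟨hup.preimage hmono, ?_, ?_⟩, ?_, ?_⟩
    · simpa using htop
    · intro a ha b hb
      simpa using hinf _ ha _ hb
    · obtain ⟨c, -, hc⟩ := hlift ∅ Set.finite_empty (Set.empty_subset _)
      exact ⟨c, hc⟩
    · intro a ha b hb
      obtain ⟨c, hc, hcP⟩ := hlift {a, b} (by simp) (by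
        rintro _ (rfl | rfl)
        exacts [ha, hb])
      exact ⟨c, hcP, hc (by simp), hc (by simp)⟩
  · intro h S hS x hx
    by_contra! hc
    have hF : Order.IsPFilter {y : N | ∃ c ∈ upperBounds S, α c ≤ y} := by
      refine isPFilter_iff.2 ⟨?_, ⟨⊤, fun _ _ => le_top, le_top⟩, ?_⟩
      · rintro y z hyz ⟨c, hc, hcy⟩
        exact ⟨c, hc, hcy.trans hyz⟩
      · rintro y ⟨c, hc, hcy⟩ z ⟨d, hd, hdz⟩
        refine ⟨c ⊓ d, fun s hs => le_inf (hc hs) (hd hs), ?_⟩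
        rw [map_inf]
        exact inf_le_inf hcy hdz
    obtain ⟨P, hP, hFP, hxP⟩ := exists_isPrimeFilter hN hF (x := x) fun ⟨c, hc', hcx⟩ => hc c hc' hcx
    obtain ⟨-, hne, hdir⟩ := isPrimeFilter_iff.1 (h P hP)
    obtain ⟨c, hcP, hcS⟩ := hdir.exists_mem_upperBounds hne hS fun s hs hsP =>
      hxP ((isPFilter_iff.1 hP.isPFilter).1 (hx ⟨s, hs, rfl⟩) hsP)
    exact hcP (hFP ⟨c, hcS, le_rfl⟩)

end PrimeFilter

/-! ### Isomorphisms of bounded distributive meet-semilattices -/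

namespace BDMSP

/-- An order isomorphism, as a morphism. -/
def homOfOrderIso {M N : BDMSP.{u}} (e : M ≃o N) : M ⟶ N where
  toInfTopHom := ⟨⟨e, map_inf e⟩, map_top e⟩
  liftsUpperBounds _ _ x hx :=
    ⟨e.symm x, fun s hs => (e.le_symm_apply).2 (hx ⟨s, hs, rfl⟩), (e.apply_symm_apply x).le⟩

/-- An order isomorphism, as an isomorphism of `BDMSP`. -/
def isoOfOrderIso {M N : BDMSP.{u}} (e : M ≃o N) : M ≅ N where
  hom := homOfOrderIso e
  inv := homOfOrderIso e.symm
  hom_inv_id := Hom.ext (DFunLike.ext _ _ fun a => e.symm_apply_apply a)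
  inv_hom_id := Hom.ext (DFunLike.ext _ _ fun a => e.apply_symm_apply a)

end BDMSP

/-! ### Join-semilattices and meet-semilattices -/

section Dual

variable {J : Type u} [SemilatticeSup J]

theorem isPrimeFilter_dual_iff {P : Set Jᵒᵈ} :
    IsPrimeFilter P ↔ IsPrimeIdealOfSup (OrderDual.toDual ⁻¹' P) :=
  ⟨fun h => ⟨h.isPFilter, h.ne_univ, fun F G hF hG hFG => h.subset_or_subset F G hF hG hFG⟩,
    fun h => ⟨h.isIdeal, h.ne_univ, fun F G hF hG hFG => h.subset_or_subset F G hF hG hFG⟩⟩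

end Dual

namespace BDJS

theorem isDistribMeetSemilattice_dual (J : BDJS.{u}) : IsDistribMeetSemilattice (J : Type u)ᵒᵈ :=
  fun a b c h => J.distrib a b c h

/-- The order dual of a bounded distributive join-semilattice. -/
def dual (J : BDJS.{u}) : BDMSP.{u} := ⟨(J : Type u)ᵒᵈ, J.isDistribMeetSemilattice_dual⟩

/-- The functor sending a bounded distributive join-semilattice to its order dual. -/
def dualFunctor : BDJS.{u} ⥤ BDMSP.{u} where
  obj := dual
  map {J K} f :=
    { toInfTopHom := SupBotHom.dual f.toSupBotHom
      liftsUpperBounds := (liftsUpperBounds_iff_isPrimeFilter_preimage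
        K.isDistribMeetSemilattice_dual _).2 fun P hP =>
          (isPrimeFilter_dual_iff (J := J)).2 (f.isPrimeIdeal_preimage _ ((isPrimeFilter_dual_iff (J := K)).1 hP)) }

instance : dualFunctor.{u}.Faithful where
  map_injective {J K f g} h := by
    refine Hom.ext (DFunLike.ext _ _ fun a => ?_)
    exact DFunLike.congr_fun (congrArg BDMSP.Hom.toInfTopHom h) (OrderDual.toDual a)

instance : dualFunctor.{u}.Full where
  map_surjective {J K} g := by
    refine ⟨⟨SupBotHom.dual.symm g.toInfTopHom, fun P hP => ?_⟩, rfl⟩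
    exact (isPrimeFilter_dual_iff (J := J)).1 ((liftsUpperBounds_iff_isPrimeFilter_preimage
      K.isDistribMeetSemilattice_dual _).1 g.liftsUpperBounds (OrderDual.ofDual ⁻¹' P)
        ((isPrimeFilter_dual_iff (J := K)).2 hP))

instance : dualFunctor.{u}.EssSurj where
  mem_essImage M :=
    ⟨⟨(M : Type u)ᵒᵈ, fun a b c h => M.distrib a b c h⟩,
      ⟨BDMSP.isoOfOrderIso (OrderIso.dualDual (M : Type u)).symm⟩⟩

instance : dualFunctor.{u}.IsEquivalence where

end BDJS

/-! ### Compact elements of algebraic frames -/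

section Compact

variable {α β : Type*} [CompleteLattice α] [CompleteLattice β]

theorem isCompactElement_bot : IsCompactElement (⊥ : α) := fun _ _ hs _ _ _ =>
  ⟨hs.some, hs.some_mem, bot_le⟩

theorem IsCompactElement.sup {a b : α} (ha : IsCompactElement a) (hb : IsCompactElement b) :
    IsCompactElement (a ⊔ b) := by
  intro s u hs hdir hu hab
  obtain ⟨x, hx, hax⟩ := ha s u hs hdir hu (le_sup_left.trans hab)
  obtain ⟨y, hy, hby⟩ := hb s u hs hdir hu (le_sup_right.trans hab)
  obtain ⟨z, hz, hxz, hyz⟩ := hdir x hx y hy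
  exact ⟨z, hz, sup_le (hax.trans hxz) (hby.trans hyz)⟩

theorem IsCompactElement.exists_le_of_le_sSup {k : α} (hk : IsCompactElement k) {s : Set α}
    (hs : s.Nonempty) (hdir : DirectedOn (· ≤ ·) s) (h : k ≤ sSup s) : ∃ x ∈ s, k ≤ x :=
  hk s _ hs hdir (isLUB_sSup s) h

/-- In an algebraic lattice, if a compact element lies below `a ⊔ b`, it lies below `k ⊔ l` for
some compact elements `k ≤ a` and `l ≤ b`. -/
theorem IsCompactElement.exists_le_sup [IsCompactlyGenerated α] {x a b : α}
    (hx : IsCompactElement x) (h : x ≤ a ⊔ b) :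
    ∃ k l : α, IsCompactElement k ∧ IsCompactElement l ∧ k ≤ a ∧ l ≤ b ∧ x ≤ k ⊔ l := by
  let s : Set α := {y | ∃ k l : α, IsCompactElement k ∧ IsCompactElement l ∧ k ≤ a ∧ l ≤ b ∧
    y = k ⊔ l}
  obtain ⟨y, ⟨k, l, hk, hl, hka, hlb, rfl⟩, hy⟩ := hx.exists_le_of_le_sSup (s := s)
    ⟨_, ⊥, ⊥, isCompactElement_bot, isCompactElement_bot, bot_le, bot_le, rfl⟩ (by
      rintro _ ⟨k, l, hk, hl, hka, hlb, rfl⟩ _ ⟨k', l', hk', hl', hka', hlb', rfl⟩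
      exact ⟨_, ⟨k ⊔ k', l ⊔ l', hk.sup hk', hl.sup hl', sup_le hka hka', sup_le hlb hlb', rfl⟩,
        sup_le_sup le_sup_left le_sup_left, sup_le_sup le_sup_right le_sup_right⟩)
    (h.trans (sup_le
      (le_iff_compact_le_imp.2 fun k hk hka =>
        le_sSup ⟨k, ⊥, hk, isCompactElement_bot, hka, bot_le, by simp⟩)
      (le_iff_compact_le_imp.2 fun l hl hlb =>
        le_sSup ⟨⊥, l, isCompactElement_bot, hl, bot_le, hlb, by simp⟩)))
  exact ⟨k, l, hk, hl, hka, hlb, hy⟩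

/-- A compact element below `f b`, where `f` preserves joins, lies below `f k` for some compact
`k ≤ b`. -/
theorem IsCompactElement.exists_le_map [IsCompactlyGenerated α] (f : sSupHom α β) {x : β} {b : α}
    (hx : IsCompactElement x) (h : x ≤ f b) : ∃ k, IsCompactElement k ∧ k ≤ b ∧ x ≤ f k := by
  obtain ⟨_, ⟨k, ⟨hk, hkb⟩, rfl⟩, hxk⟩ := hx.exists_le_of_le_sSup
    (s := f '' {k | IsCompactElement k ∧ k ≤ b})
    ⟨_, ⊥, ⟨isCompactElement_bot, bot_le⟩, rfl⟩ (by
      rintro _ ⟨k, ⟨hk, hkb⟩, rfl⟩ _ ⟨l, ⟨hl, hlb⟩, rfl⟩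
      exact ⟨_, ⟨k ⊔ l, ⟨hk.sup hl, sup_le hkb hlb⟩, rfl⟩, OrderHomClass.mono f le_sup_left,
        OrderHomClass.mono f le_sup_right⟩) (by
      rw [← map_sSup]
      exact h.trans (OrderHomClass.mono f (sSup_compact_le_eq b).ge))
  exact ⟨k, hk, hkb, hxk⟩

end Compact

namespace KAlgFrm

variable {L M : KAlgFrm.{u}}

/-- The compact elements of a compact algebraic frame. -/
abbrev Compacts (L : KAlgFrm.{u}) : Type u := {k : L // IsCompactElement k}

instance : SemilatticeSup L.Compacts := Subtype.semilatticeSup fun _ _ => IsCompactElement.sup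

instance : BoundedOrder L.Compacts where
  top := ⟨⊤, L.isCompactElement_top⟩
  le_top k := le_top (a := (k : L))
  bot := ⟨⊥, isCompactElement_bot⟩
  bot_le k := bot_le (a := (k : L))

/-- In the frame `c = (c ⊓ a) ⊔ (c ⊓ b)`, but these meets need not be compact. Compactness of `c`
lets them be replaced by compact elements below them with the same join. -/
theorem isDistribMeetSemilattice_compacts (L : KAlgFrm.{u}) :
    IsDistribMeetSemilattice (L.Compacts)ᵒᵈ := by
  intro a b c h
  obtain ⟨⟨a, ha⟩, rfl⟩ := OrderDual.toDual.surjective a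
  obtain ⟨⟨b, hb⟩, rfl⟩ := OrderDual.toDual.surjective b
  obtain ⟨⟨c, hc⟩, rfl⟩ := OrderDual.toDual.surjective c
  have h' : c ≤ a ⊔ b := h
  have hc' : c ≤ (c ⊓ a) ⊔ (c ⊓ b) := by
    rw [← inf_sup_left]
    exact le_inf le_rfl h'
  obtain ⟨k, l, hk, hl, hka, hlb, hckl⟩ := hc.exists_le_sup hc'
  exact ⟨OrderDual.toDual ⟨k, hk⟩, OrderDual.toDual ⟨l, hl⟩, hka.trans inf_le_right,
    hlb.trans inf_le_right, Subtype.ext (le_antisymm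
      (sup_le (hka.trans inf_le_left) (hlb.trans inf_le_left)) hckl)⟩

/-- The compact elements of a compact algebraic frame under the reverse order. -/
def compactsDual (L : KAlgFrm.{u}) : BDMSP.{u} :=
  ⟨(L.Compacts)ᵒᵈ, L.isDistribMeetSemilattice_compacts⟩

/-- The action of a morphism on compact elements. -/
def Hom.mapCompacts (f : Hom L M) : SupBotHom L.Compacts M.Compacts where
  toFun k := ⟨f.toFrameHom k, f.map_isCompactElement k k.2⟩
  map_sup' a b := Subtype.ext (map_sup f.toFrameHom (a : L) b)
  map_bot' := Subtype.ext (map_bot f.toFrameHom)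

/-- Since `f` preserves the finite meet of `S` taken in the frame, `x` lies below its image;
compactness of `x` then replaces that possibly non-compact meet by a compact element under it. -/
theorem Hom.exists_mem_lowerBounds (f : Hom L M) {S : Set L.Compacts} (hS : S.Finite)
    {x : M.Compacts} (hx : x ∈ lowerBounds (f.mapCompacts '' S)) :
    ∃ c ∈ lowerBounds S, x ≤ f.mapCompacts c := by
  have hx' : (x : M) ≤ f.toFrameHom (hS.toFinset.inf (↑)) := by
    rw [map_finset_inf]
    exact Finset.le_inf fun s hs => hx ⟨s, hS.mem_toFinset.1 hs, rfl⟩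
  obtain ⟨k, hk, hkS, hxk⟩ := x.2.exists_le_map (f.toFrameHom : sSupHom L M) hx'
  exact ⟨⟨k, hk⟩, fun s hs => hkS.trans (Finset.inf_le (hS.mem_toFinset.2 hs)), hxk⟩

/-- The functor sending a compact algebraic frame to its compact elements under the reverse
order. -/
def compactsFunctor : KAlgFrm.{u} ⥤ BDMSP.{u} where
  obj := compactsDual
  map f :=
    { toInfTopHom := SupBotHom.dual (Hom.mapCompacts f)
      liftsUpperBounds := fun _ hS _ hx => Hom.exists_mem_lowerBounds f hS hx }

instance : compactsFunctor.{u}.Faithful where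
  map_injective {L M f g} h := by
    have hfg (k : L) (hk : IsCompactElement k) : f.toFrameHom k = g.toFrameHom k := by
      have := DFunLike.congr_fun (congrArg BDMSP.Hom.toInfTopHom h)
        (OrderDual.toDual (⟨k, hk⟩ : L.Compacts))
      exact congrArg Subtype.val this
    refine Hom.ext (DFunLike.ext _ _ fun (a : L) => ?_)
    rw [← sSup_compact_le_eq a, map_sSup, map_sSup]
    exact congrArg sSup (Set.image_congr fun k hk => hfg k hk.1)

/-! ### Extending maps of compact elements to frame morphisms -/

section Extend

variable (α : SupBotHom L.Compacts M.Compacts)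

/-- The extension of a map between compact elements that preserves joins. -/
def extendFun (a : L) : M := sSup {y | ∃ k : L.Compacts, (k : L) ≤ a ∧ y = α k}

variable {α}

theorem le_extendFun {k : L.Compacts} {a : L} (h : (k : L) ≤ a) : (α k : M) ≤ extendFun α a :=
  le_sSup ⟨k, h, rfl⟩

theorem extendFun_le {a : L} {b : M} (h : ∀ k : L.Compacts, (k : L) ≤ a → (α k : M) ≤ b) :
    extendFun α a ≤ b :=
  sSup_le fun _ ⟨k, hk, hy⟩ => hy.trans_le (h k hk)

theorem extendFun_mono : Monotone (extendFun α) := fun _ _ h =>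
  extendFun_le fun _ hk => le_extendFun (hk.trans h)

theorem extendFun_coe (k : L.Compacts) : extendFun α k = α k :=
  le_antisymm (extendFun_le fun _ hl => OrderHomClass.mono α hl) (le_extendFun le_rfl)

theorem exists_le_of_le_extendFun {x : M} (hx : IsCompactElement x) {a : L}
    (h : x ≤ extendFun α a) : ∃ k : L.Compacts, (k : L) ≤ a ∧ x ≤ α k := by
  obtain ⟨_, ⟨k, hk, rfl⟩, hxk⟩ := hx.exists_le_of_le_sSup
    (s := {y | ∃ k : L.Compacts, (k : L) ≤ a ∧ y = α k}) ⟨_, ⊥, bot_le, rfl⟩ (by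
    rintro _ ⟨k, hk, rfl⟩ _ ⟨l, hl, rfl⟩
    exact ⟨_, ⟨k ⊔ l, sup_le hk hl, rfl⟩, OrderHomClass.mono α (le_sup_left (a := k)),
      OrderHomClass.mono α (le_sup_right (a := k))⟩) h
  exact ⟨k, hk, hxk⟩

theorem extendFun_sSup (A : Set L) : extendFun α (sSup A) = sSup (extendFun α '' A) := by
  refine le_antisymm (extendFun_le fun k hk => ?_)
    (sSup_le (Set.forall_mem_image.2 fun a ha => extendFun_mono (le_sSup ha)))
  -- The compact `d` with `α d` below the target join are closed under finite joins and include
  -- every compact below a member of `A`. Their join therefore dominates `k`, so a single such `d`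
  -- does.
  obtain ⟨_, ⟨d, hd, rfl⟩, hkd⟩ := k.2.exists_le_of_le_sSup
    (s := {x | ∃ d : L.Compacts, (α d : M) ≤ sSup (extendFun α '' A) ∧ x = d})
    ⟨_, ⊥, by rw [map_bot]; exact bot_le, rfl⟩ (by
      rintro _ ⟨d, hd, rfl⟩ _ ⟨e, he, rfl⟩
      exact ⟨_, ⟨d ⊔ e, by rw [map_sup]; exact sup_le hd he, rfl⟩, le_sup_left (a := d.1),
        le_sup_right (a := d.1)⟩)
    (hk.trans (sSup_le fun a ha => le_iff_compact_le_imp.2 fun c hc hca =>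
      le_sSup ⟨⟨c, hc⟩, (le_extendFun hca).trans (le_sSup ⟨a, ha, rfl⟩), rfl⟩))
  exact le_trans (OrderHomClass.mono α hkd) hd

/-- A compact element below both images lies below `α k` and `α l` with `k ≤ a`, `l ≤ b`; the
hypothesis for the pair `{k, l}` moves it below `α c` with `c ≤ a ⊓ b`. -/
theorem extendFun_inf (hα : ∀ S : Set L.Compacts, S.Finite → ∀ x ∈ lowerBounds (α '' S),
    ∃ c ∈ lowerBounds S, x ≤ α c) (a b : L) :
    extendFun α (a ⊓ b) = extendFun α a ⊓ extendFun α b := by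
  refine le_antisymm (le_inf (extendFun_mono inf_le_left) (extendFun_mono inf_le_right))
    (le_iff_compact_le_imp.2 fun x hx hxab => ?_)
  obtain ⟨k, hk, hxk⟩ := exists_le_of_le_extendFun hx (hxab.trans inf_le_left)
  obtain ⟨l, hl, hxl⟩ := exists_le_of_le_extendFun hx (hxab.trans inf_le_right)
  obtain ⟨c, hc, hxc⟩ := hα {k, l} (by simp) ⟨x, hx⟩ (by
    rintro _ ⟨_, rfl | rfl, rfl⟩
    exacts [hxk, hxl])
  have hck : c ≤ k := hc (by simp)
  have hcl : c ≤ l := hc (by simp)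
  exact le_trans hxc (le_extendFun (le_inf (le_trans hck hk) (le_trans hcl hl)))

theorem extendFun_top (hα : ∀ S : Set L.Compacts, S.Finite → ∀ x ∈ lowerBounds (α '' S),
    ∃ c ∈ lowerBounds S, x ≤ α c) : extendFun α ⊤ = ⊤ := by
  obtain ⟨c, -, hc⟩ := hα ∅ Set.finite_empty ⊤ (by simp)
  exact top_le_iff.1 (le_trans hc (le_extendFun le_top))

end Extend

instance : compactsFunctor.{u}.Full where
  map_surjective {L M} g := by
    let α : SupBotHom L.Compacts M.Compacts := SupBotHom.dual.symm g.toInfTopHom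
    have hα : ∀ S : Set L.Compacts, S.Finite → ∀ x ∈ lowerBounds (α '' S),
      ∃ c ∈ lowerBounds S, x ≤ α c := g.liftsUpperBounds
    refine ⟨⟨⟨⟨⟨extendFun α, extendFun_inf hα⟩, extendFun_top hα⟩, extendFun_sSup⟩,
      fun k hk => ?_⟩, ?_⟩
    · change IsCompactElement (extendFun α (⟨k, hk⟩ : L.Compacts))
      rw [extendFun_coe]
      exact (α ⟨k, hk⟩).2
    · exact BDMSP.Hom.ext (DFunLike.ext _ _ fun k =>
        Subtype.ext (extendFun_coe (α := α) (OrderDual.ofDual k)))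

end KAlgFrm

/-! ### The frame of ideals of a distributive join-semilattice -/

namespace Order.Ideal

variable {J : Type u} [SemilatticeSup J]

theorem isCompactElement_principal [OrderBot J] (a : J) : IsCompactElement (principal a) := by
  rw [CompleteLattice.isCompactElement_iff_le_of_directed_sSup_le]
  intro S hS hdir ha
  -- A directed union of ideals is an ideal, so directed joins are unions and a principal ideal is
  -- caught by one member.
  have hI : Order.IsIdeal (⋃₀ ((↑) '' S : Set (Set J))) := by
    refine isIdeal_sUnion_of_directedOn ?_ ?_ (hS.image _)
    · rintro _ ⟨I, -, rfl⟩
      exact I.isIdeal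
    · rintro _ ⟨I, hI, rfl⟩ _ ⟨K, hK, rfl⟩
      obtain ⟨T, hT, hIT, hKT⟩ := hdir I hI K hK
      exact ⟨_, ⟨T, hT, rfl⟩, hIT, hKT⟩
  have hle : sSup S ≤ hI.toIdeal := sSup_le fun I hIS x hx => ⟨I, ⟨I, hIS, rfl⟩, hx⟩
  obtain ⟨_, ⟨I, hIS, rfl⟩, haI⟩ := hle (ha (mem_principal_self (x := a)))
  exact ⟨I, hIS, principal_le_iff.2 haI⟩

theorem isLUB_principal_image (I : Ideal J) : IsLUB (principal '' (I : Set J)) I :=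
  ⟨Set.forall_mem_image.2 fun _ ha => principal_le_iff.2 ha,
    fun _ hK a ha => principal_le_iff.1 (hK ⟨a, ha, rfl⟩)⟩

theorem exists_eq_principal [OrderBot J] {I : Ideal J} (hI : IsCompactElement I) :
    ∃ a, principal a = I := by
  obtain ⟨_, ⟨a, ha, rfl⟩, hIa⟩ := hI _ _ (I.nonempty.image _) (by
    rintro _ ⟨a, ha, rfl⟩ _ ⟨b, hb, rfl⟩
    exact ⟨_, ⟨a ⊔ b, sup_mem ha hb, rfl⟩, principal_le_iff.2 le_sup_left,
      principal_le_iff.2 le_sup_right⟩) I.isLUB_principal_image le_rfl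
  exact ⟨a, le_antisymm (principal_le_iff.2 ha) hIa⟩

instance [OrderBot J] : IsCompactlyGenerated (Ideal J) where
  exists_sSup_eq I := ⟨_, Set.forall_mem_image.2 fun a _ => isCompactElement_principal a,
    I.isLUB_principal_image.sSup_eq⟩

/-- The ideals of a distributive join-semilattice form a frame. -/
@[reducible]
def frame [OrderBot J] (hJ : IsDistribJoinSemilattice J) : Order.Frame (Ideal J) :=
  .ofMinimalAxioms
    { inf_sSup_le_iSup_inf := fun I S => by
        -- This is the Heyting implication from `I` to the join of the `I ⊓ s`. Distributivity makes
        -- it an ideal: an element below `x ⊔ z` splits into parts below `x` and `z`. It contains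
        -- each `s`, hence `sSup S`.
        have hK : Order.IsIdeal {x : J | ∀ y ≤ x, y ∈ I → y ∈ ⨆ s ∈ S, I ⊓ s} := by
          refine ⟨fun x z hzx hx y hy => hx y (hy.trans hzx), ⟨⊥, fun y hy _ => ?_⟩, ?_⟩
          · rw [le_bot_iff.1 hy]
            exact bot_mem _
          · refine fun x hx z hz => ⟨x ⊔ z, fun y hy hyI => ?_, le_sup_left, le_sup_right⟩
            obtain ⟨x', z', hx', hz', rfl⟩ := hJ _ _ _ hy
            exact sup_mem (hx _ hx' (I.lower le_sup_left hyI)) (hz _ hz' (I.lower le_sup_right hyI))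
        have hle : sSup S ≤ hK.toIdeal := sSup_le fun s hs x hx y hyx hyI =>
          (le_iSup₂ (f := fun s _ => I ⊓ s) s hs : I ⊓ s ≤ _) ⟨hyI, s.lower hyx hx⟩
        exact fun x hx => hle hx.2 x le_rfl hx.1 }

end Order.Ideal

namespace BDMSP

theorem isDistribJoinSemilattice_dual (M : BDMSP.{u}) :
    IsDistribJoinSemilattice (M : Type u)ᵒᵈ :=
  fun a b c h => M.distrib a b c h

/-- The compact algebraic frame of filters of a bounded distributive meet-semilattice, realized as
ideals of the order dual. -/
def filterFrame (M : BDMSP.{u}) : KAlgFrm.{u} :=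
  letI := Order.Ideal.frame M.isDistribJoinSemilattice_dual
  { carrier := Order.Ideal (M : Type u)ᵒᵈ
    isCompactElement_top := by
      rw [← Order.Ideal.principal_top]
      exact Order.Ideal.isCompactElement_principal _ }

/-- A bounded distributive meet-semilattice is dual to the compact elements of its frame of
filters. -/
noncomputable def compactsFilterFrameIso (M : BDMSP.{u}) : M ≃o M.filterFrame.compactsDual :=
  let e : (M : Type u)ᵒᵈ ≃o M.filterFrame.Compacts := RelIso.ofSurjective
    (OrderEmbedding.ofMapLEIff
      (fun a => ⟨Order.Ideal.principal a, Order.Ideal.isCompactElement_principal a⟩)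
      fun _ _ => Order.Ideal.principal_le_iff) fun I =>
        (Order.Ideal.exists_eq_principal I.2).imp fun _ => Subtype.ext
  (OrderIso.dualDual (M : Type u)).trans e.dual

end BDMSP

namespace KAlgFrm

instance : compactsFunctor.{u}.EssSurj where
  mem_essImage M := ⟨M.filterFrame, ⟨BDMSP.isoOfOrderIso M.compactsFilterFrameIso.symm⟩⟩

instance : compactsFunctor.{u}.IsEquivalence where

end KAlgFrm

/-! ### Admissible clopen upsets -/

section Admissible

variable {X : Type u} [TopologicalSpace X] [PartialOrder X] {X₀ : Set X}

/-- The admissible clopen upsets relative to a subset. -/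
abbrev AdmissibleUpset (X₀ : Set X) : Type u := {U : Set X // IsAdmissible X₀ U}

theorem IsAdmissible.inter {U V : Set X} (hU : IsAdmissible X₀ U) (hV : IsAdmissible X₀ V) :
    IsAdmissible X₀ (U ∩ V) where
  isClopen := hU.isClopen.inter hV.isClopen
  isUpperSet := hU.isUpperSet.inter hV.isUpperSet
  maximal_mem x hx := by
    by_cases hxU : x ∈ U
    · exact hV.maximal_mem x ⟨fun hxV => hx.prop ⟨hxU, hxV⟩,
        fun y hy hxy => hx.le_of_ge (fun h => hy h.2) hxy⟩
    · exact hU.maximal_mem x ⟨hxU, fun y hy hxy => hx.le_of_ge (fun h => hy h.1) hxy⟩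

theorem isAdmissible_univ : IsAdmissible X₀ Set.univ :=
  ⟨isClopen_univ, isUpperSet_univ, fun x hx => (hx.prop (Set.mem_univ x)).elim⟩

instance : SemilatticeInf (AdmissibleUpset X₀) :=
  Subtype.semilatticeInf fun _ _ => IsAdmissible.inter

instance : OrderTop (AdmissibleUpset X₀) where
  top := ⟨Set.univ, isAdmissible_univ⟩
  le_top U := Set.subset_univ U.1

theorem coe_inf_admissibleUpset (U V : AdmissibleUpset X₀) :
    ((U ⊓ V : AdmissibleUpset X₀) : Set X) = (U : Set X) ∩ V := rfl

theorem mem_finset_inf_admissibleUpset {ι : Type*} {T : Finset ι} {g : ι → AdmissibleUpset X₀}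
    {x : X} : x ∈ (T.inf g).1 ↔ ∀ i ∈ T, x ∈ (g i).1 := by
  classical
  induction T using Finset.induction_on with
  | empty => exact iff_of_true (Set.mem_univ x) (by simp)
  | insert i T _ ih =>
    rw [Finset.inf_insert, coe_inf_admissibleUpset, Set.mem_inter_iff, ih, Finset.forall_mem_insert]

/-- In a compact Priestley space, every element of a closed set lies below a maximal one. -/
theorem IsClosed.exists_le_maximal [CompactSpace X] [PriestleySpace X] {C : Set X}
    (hC : IsClosed C) {x : X} (hx : x ∈ C) : ∃ m, x ≤ m ∧ Maximal (· ∈ C) m := by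
  have hIci (y : X) : IsClosed (Set.Ici y) := by
    refine isOpen_compl_iff.1 (isOpen_iff_forall_mem_open.2 fun z hz => ?_)
    obtain ⟨U, hU, hUup, hyU, hzU⟩ := exists_isClopen_upper_of_not_le (x := y) (y := z) hz
    exact ⟨Uᶜ, fun w hw hyw => hw (hUup hyw hyU), hU.compl.isOpen, hzU⟩
  refine zorn_le_nonempty₀ C (fun c hcC hchain y hy => ?_) x hx
  have : Nonempty c := ⟨⟨y, hy⟩⟩
  obtain ⟨z, hz⟩ := IsCompact.nonempty_iInter_of_directed_nonempty_isCompact_isClosed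
    (fun i : c => Set.Ici (i : X) ∩ C)
    (fun i j => by
      rcases hchain.total i.2 j.2 with h | h
      · exact ⟨j, Set.inter_subset_inter_left _ (Set.Ici_subset_Ici.2 h), le_rfl⟩
      · exact ⟨i, le_rfl, Set.inter_subset_inter_left _ (Set.Ici_subset_Ici.2 h)⟩)
    (fun i => ⟨i, le_rfl, hcC i.2⟩)
    (fun i => ((hIci i).inter hC).isCompact)
    (fun i => (hIci i).inter hC)
  rw [Set.mem_iInter] at hz
  exact ⟨z, (hz ⟨y, hy⟩).2, fun i hi => (hz ⟨i, hi⟩).1⟩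

/-- If the complement of an admissible clopen upset `W` misses, at each of its points in `X₀`, some
member of a family of admissible clopen upsets, then `W` contains a finite intersection of members
of the family. -/
theorem exists_finset_inf_le [CompactSpace X] [PriestleySpace X] {ι : Type*}
    (g : ι → AdmissibleUpset X₀) (W : AdmissibleUpset X₀)
    (h : ∀ x ∈ X₀, x ∉ W.1 → ∃ i, x ∉ (g i).1) : ∃ T : Finset ι, T.inf g ≤ W := by
  obtain ⟨T, hT⟩ := W.2.isClopen.compl.isClosed.isCompact.elim_finite_subcover
    (fun i => (g i).1ᶜ) (fun i => (g i).2.isClopen.compl.isOpen) fun x hx => by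
      -- Moving up to a maximal point of the complement reaches `X₀`, where the hypothesis applies;
      -- an upset missing `m` also misses `x`.
      obtain ⟨m, hxm, hm⟩ := IsClosed.exists_le_maximal W.2.isClopen.compl.isClosed hx
      obtain ⟨i, hi⟩ := h m (W.2.maximal_mem m hm) hm.prop
      exact Set.mem_iUnion.2 ⟨i, fun hxi => hi ((g i).2.isUpperSet hxm hxi)⟩
  refine ⟨T, fun x hx => ?_⟩
  by_contra hxW
  obtain ⟨i, hi, hxi⟩ := Set.mem_iUnion₂.1 (hT hxW)
  exact hxi (mem_finset_inf_admissibleUpset.1 hx i hi)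

/-- A point of `X₀` outside `W` misses `U` or `V`, so directedness gives an admissible set
containing `W` and that one, still missing the point. By compactness `W` is a finite intersection of
such sets; grouping those above `U` and those above `V` gives the two factors. -/
theorem isDistribMeetSemilattice_admissibleUpset [CompactSpace X] [PriestleySpace X]
    (hX₀ : ∀ x ∈ X₀, DirectedOn (· ≤ ·) {U : AdmissibleUpset X₀ | x ∉ U.1}) :
    IsDistribMeetSemilattice (AdmissibleUpset X₀) := by
  classical
  intro U V W hUVW
  let ι := {C : AdmissibleUpset X₀ // W ≤ C ∧ (U ≤ C ∨ V ≤ C)}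
  obtain ⟨T, hT⟩ := exists_finset_inf_le (fun C : ι => C.1) W fun x hx hxW => by
    have hxUV : x ∉ U.1 ∨ x ∉ V.1 := by
      by_contra! h
      exact hxW (hUVW h)
    rcases hxUV with h | h
    · obtain ⟨C, hC, hUC, hWC⟩ := hX₀ x hx U h W hxW
      exact ⟨⟨C, hWC, .inl hUC⟩, hC⟩
    · obtain ⟨C, hC, hVC, hWC⟩ := hX₀ x hx V h W hxW
      exact ⟨⟨C, hWC, .inr hVC⟩, hC⟩
  refine ⟨{i ∈ T | U ≤ i.1}.inf Subtype.val, {i ∈ T | V ≤ i.1}.inf Subtype.val,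
    Finset.le_inf fun i hi => (Finset.mem_filter.1 hi).2,
    Finset.le_inf fun i hi => (Finset.mem_filter.1 hi).2,
    le_antisymm (le_trans (Finset.le_inf fun i hi => ?_) hT)
      (le_inf (Finset.le_inf fun i _ => i.2.1) (Finset.le_inf fun i _ => i.2.1))⟩
  rcases i.2.2 with h | h
  · exact inf_le_left.trans (Finset.inf_le (Finset.mem_filter.2 ⟨hi, h⟩))
  · exact inf_le_right.trans (Finset.inf_le (Finset.mem_filter.2 ⟨hi, h⟩))

end Admissible

namespace GPSP

variable {X Y : GPSP.{u}}

theorem isAdmissible_empty (X : GPSP.{u}) : IsAdmissible X.core ∅ where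
  isClopen := isClopen_empty
  isUpperSet := isUpperSet_empty
  maximal_mem x hx := by
    obtain ⟨y, hy, hxy⟩ := X.exists_le_core x
    rwa [hx.eq_of_le (Set.notMem_empty y) hxy]

instance : BoundedOrder (AdmissibleUpset X.core) where
  bot := ⟨∅, X.isAdmissible_empty⟩
  bot_le U := Set.empty_subset U.1

theorem mem_core_iff_directedOn {x : X} :
    x ∈ X.core ↔ DirectedOn (· ≤ ·) {U : AdmissibleUpset X.core | x ∉ U.1} := by
  rw [X.mem_core_iff]
  constructor
  · intro h U hU V hV
    obtain ⟨W, ⟨hW, hxW⟩, hUW, hVW⟩ := h U ⟨U.2, hU⟩ V ⟨V.2, hV⟩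
    exact ⟨⟨W, hW⟩, hxW, hUW, hVW⟩
  · rintro h U ⟨hU, hxU⟩ V ⟨hV, hxV⟩
    obtain ⟨W, hxW, hUW, hVW⟩ := h ⟨U, hU⟩ hxU ⟨V, hV⟩ hxV
    exact ⟨W, ⟨W.2, hxW⟩, hUW, hVW⟩

theorem exists_mem_upperBounds {x : X} (hx : x ∈ X.core) {S : Set (AdmissibleUpset X.core)}
    (hS : S.Finite) (h : ∀ U ∈ S, x ∉ U.1) : ∃ C ∈ upperBounds S, x ∉ C.1 := by
  obtain ⟨C, hC, hCS⟩ := (mem_core_iff_directedOn.1 hx).exists_mem_upperBounds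
    ⟨⊥, Set.notMem_empty x⟩ hS h
  exact ⟨C, hCS, hC⟩

theorem eq_of_forall_mem_iff {x y : X} (h : ∀ U, IsAdmissible X.core U → (x ∈ U ↔ y ∈ U)) :
    x = y :=
  le_antisymm ((X.le_iff x y).2 fun U hU => (h U hU).1) ((X.le_iff y x).2 fun U hU => (h U hU).2)

/-- The bounded distributive meet-semilattice of admissible clopen upsets. -/
def admissibleUpsets (X : GPSP.{u}) : BDMSP.{u} :=
  ⟨AdmissibleUpset X.core, isDistribMeetSemilattice_admissibleUpset fun _ hx =>
    mem_core_iff_directedOn.1 hx⟩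

/-- The inverse image map on admissible clopen upsets. -/
def Hom.preimage (f : Hom X Y) :
    InfTopHom (AdmissibleUpset Y.core) (AdmissibleUpset X.core) where
  toFun U := ⟨f.toOrderHom ⁻¹' U, f.isAdmissible_preimage U U.2⟩
  map_inf' _ _ := rfl
  map_top' := rfl

/-- At a core point `x` outside `W`, the point `f x` is in the core and misses every member of `S`,
hence misses some upper bound of `S`. By compactness finitely many of these bounds suffice, and
their intersection still bounds `S`. -/
theorem Hom.liftsUpperBounds_preimage (f : Hom X Y) : LiftsUpperBounds f.preimage := by
  intro S hS W hW
  obtain ⟨T, hT⟩ := exists_finset_inf_le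
    (fun C : upperBounds S => f.preimage (C : AdmissibleUpset Y.core)) W fun x hx hxW => by
      obtain ⟨C, hC, hxC⟩ := exists_mem_upperBounds (f.map_core x hx) hS
        fun U hU hxU => hxW (hW ⟨U, hU, rfl⟩ hxU)
      exact ⟨⟨C, hC⟩, hxC⟩
  refine ⟨T.inf Subtype.val, fun U hU => Finset.le_inf fun C _ => C.2 hU, ?_⟩
  rw [map_finset_inf]
  exact hT

/-- The functor sending a generalized Priestley space to its admissible clopen upsets. -/
def admissibleFunctor : GPSP.{u}ᵒᵖ ⥤ BDMSP.{u} where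
  obj X := X.unop.admissibleUpsets
  map f := ⟨Hom.preimage f.unop, Hom.liftsUpperBounds_preimage f.unop⟩

instance : admissibleFunctor.{u}.Faithful where
  map_injective {X Y f g} h := by
    refine Quiver.Hom.unop_inj (Hom.ext (OrderHom.ext _ _ (funext fun x => ?_)))
    refine eq_of_forall_mem_iff fun U hU => ?_
    have := DFunLike.congr_fun (congrArg BDMSP.Hom.toInfTopHom h)
      (⟨U, hU⟩ : AdmissibleUpset X.unop.core)
    exact Set.ext_iff.1 (congrArg Subtype.val this) x

/-- Fullness needs a point `y` with prescribed memberships. Each prescription is a closed condition,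
so compactness leaves finitely many; density then permits testing their consistency at a core point
of `X`, where upper bounds are available. -/
theorem exists_forall_mem_iff
    {α : InfTopHom (AdmissibleUpset Y.core) (AdmissibleUpset X.core)} (hα : LiftsUpperBounds α)
    (x : X) : ∃ y : Y, ∀ U : AdmissibleUpset Y.core, y ∈ U.1 ↔ x ∈ (α U).1 := by
  let K : AdmissibleUpset Y.core → Set Y := fun U => {y | y ∈ U.1 ↔ x ∈ (α U).1}
  have hK (U) : IsClosed (K U) := by
    by_cases hxU : x ∈ (α U).1
    · simpa [K, hxU] using U.2.isClopen.isClosed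
    · have : K U = U.1ᶜ := by
        ext y
        simp [K, hxU]
      exact this ▸ U.2.isClopen.compl.isClosed
  have hne : (⋂ U, K U).Nonempty := by
    refine CompactSpace.iInter_nonempty hK fun T => ?_
    by_contra! hT
    classical
    let V : AdmissibleUpset Y.core := {U ∈ T | x ∈ (α U).1}.inf id
    have hxV : x ∈ (α V).1 := by
      rw [map_finset_inf, mem_finset_inf_admissibleUpset]
      exact fun U hU => (Finset.mem_filter.1 hU).2
    let S : Finset (AdmissibleUpset Y.core) := {U ∈ T | x ∉ (α U).1}
    have hVS (y : Y) (hy : y ∈ V.1) : ∃ U ∈ S, y ∈ U.1 := by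
      by_contra! hyS
      refine Set.eq_empty_iff_forall_notMem.1 hT y (Set.mem_iInter₂.2 fun U hU => ?_)
      by_cases hxU : x ∈ (α U).1
      · exact iff_of_true
          (mem_finset_inf_admissibleUpset.1 hy U (Finset.mem_filter.2 ⟨hU, hxU⟩)) hxU
      · exact iff_of_false (hyS U (Finset.mem_filter.2 ⟨hU, hxU⟩)) hxU
    have hopen : IsOpen ((α V).1 ∩ ⋂ U ∈ S, (α U).1ᶜ) :=
      (α V).2.isClopen.isOpen.inter
        (isOpen_biInter_finset fun U _ => (α U).2.isClopen.compl.isOpen)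
    -- The finitely many conditions at `x` cut out an open set, so a core point `z` satisfies them
    -- too.
    obtain ⟨z, ⟨hzV, hzS⟩, hz⟩ := X.dense_core.inter_open_nonempty _ hopen
      ⟨x, hxV, Set.mem_iInter₂.2 fun U hU => (Finset.mem_filter.1 hU).2⟩
    rw [Set.mem_iInter₂] at hzS
    obtain ⟨W, hW, hzW⟩ := exists_mem_upperBounds hz (S.finite_toSet.image α) (by
      rintro _ ⟨U, hU, rfl⟩
      exact hzS U hU)
    obtain ⟨C, hC, hCW⟩ := hα S S.finite_toSet W hW
    -- Inconsistency says that `V` is covered by the members of `S`, so any upper bound of `S`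
    -- contains it. Then `z ∈ α V ⊆ α C ⊆ W`, although `W` was chosen to miss `z`.
    have hVC : V ≤ C := fun y hy => by
      obtain ⟨U, hU, hyU⟩ := hVS y hy
      exact hC hU hyU
    exact hzW (hCW ((OrderHomClass.mono α hVC : α V ≤ α C) hzV))
  obtain ⟨y, hy⟩ := hne
  exact ⟨y, fun U => Set.mem_iInter.1 hy U⟩

instance : admissibleFunctor.{u}.Full where
  map_surjective {Y X} g := by
    let α : InfTopHom (AdmissibleUpset Y.unop.core) (AdmissibleUpset X.unop.core) := g.toInfTopHom
    have hα : LiftsUpperBounds α := g.liftsUpperBounds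
    choose f hf using exists_forall_mem_iff hα
    let F : Hom X.unop Y.unop :=
      { toOrderHom := ⟨f, fun x y hxy => (Y.unop.le_iff _ _).2 fun U hU hx =>
          (hf y ⟨U, hU⟩).2 ((α ⟨U, hU⟩).2.isUpperSet hxy ((hf x ⟨U, hU⟩).1 hx))⟩
        isAdmissible_preimage := fun U hU => by
          have : f ⁻¹' U = (α ⟨U, hU⟩).1 := Set.ext fun x => hf x ⟨U, hU⟩
          change IsAdmissible _ (f ⁻¹' U)
          exact this ▸ (α ⟨U, hU⟩).2
        map_core := fun x hx => mem_core_iff_directedOn.2 fun U hU V hV => by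
          obtain ⟨W, hW, hxW⟩ := exists_mem_upperBounds hx (S := α '' {U, V})
            ((Set.toFinite {U, V}).image α) (by
              rintro _ ⟨_, rfl | rfl, rfl⟩
              exacts [fun h => hU ((hf x _).2 h), fun h => hV ((hf x _).2 h)])
          obtain ⟨C, hC, hCW⟩ := hα {U, V} (Set.toFinite _) W hW
          exact ⟨C, fun h => hxW (hCW ((hf x C).1 h)), hC (by simp), hC (by simp)⟩ }
    exact ⟨Quiver.Hom.op F, BDMSP.Hom.ext (DFunLike.ext _ _ fun U =>
      Subtype.ext (Set.ext fun x => hf x U))⟩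

end GPSP

/-! ### The space of optimal filters -/

section Optimal

variable {M : Type u} [SemilatticeInf M]

/-- A filter `P` is optimal if a finite set meets `P` as soon as some element of `P` lies below all
of its upper bounds. -/
structure IsOptimalFilter (P : Set M) : Prop where
  isPFilter : Order.IsPFilter P
  exists_mem : ∀ S : Finset M, ∀ a ∈ P, (∀ c ∈ upperBounds (S : Set M), a ≤ c) → ∃ s ∈ S, s ∈ P

theorem IsPrimeFilter.isOptimalFilter [OrderTop M] {P : Set M} (hP : IsPrimeFilter P) :
    IsOptimalFilter P where
  isPFilter := hP.isPFilter
  exists_mem S a ha haS := by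
    by_contra! h
    obtain ⟨-, hne, hdir⟩ := isPrimeFilter_iff.1 hP
    obtain ⟨c, hc, hcS⟩ := hdir.exists_mem_upperBounds hne S.finite_toSet h
    exact hc ((isPFilter_iff.1 hP.isPFilter).1 (haS c hcS) ha)

/-- The case of the empty set: every element is an upper bound of it, so optimality includes
properness. -/
theorem IsOptimalFilter.bot_notMem [BoundedOrder M] {P : Set M} (hP : IsOptimalFilter P) :
    ⊥ ∉ P := fun h => by
  obtain ⟨s, hs, -⟩ := hP.exists_mem ∅ ⊥ h fun _ _ => bot_le
  exact Finset.notMem_empty s hs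

end Optimal

namespace BDMSP

variable {M : BDMSP.{u}}

/-- The optimal filters of a bounded distributive meet-semilattice, as `Bool`-valued functions. -/
abbrev OptimalFilter (M : BDMSP.{u}) : Type u := {p : M → Bool // IsOptimalFilter {a | p a = true}}

namespace OptimalFilter

variable {p q : M.OptimalFilter}

theorem le_iff : p ≤ q ↔ ∀ a, p.1 a = true → q.1 a = true :=
  forall_congr' fun _ => Bool.le_iff_imp

/-- A prime filter as an optimal filter. -/
noncomputable def ofPrime {P : Set M} (hP : IsPrimeFilter P) : M.OptimalFilter :=
  open Classical in ⟨fun a => decide (a ∈ P), by simpa using hP.isOptimalFilter⟩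

@[simp]
theorem ofPrime_apply {P : Set M} (hP : IsPrimeFilter P) (a : M) :
    (ofPrime hP).1 a = true ↔ a ∈ P := by
  simp [ofPrime]

/-- The prime filters among the optimal filters. -/
def core (M : BDMSP.{u}) : Set M.OptimalFilter := {p | IsPrimeFilter {a | p.1 a = true}}

theorem ofPrime_mem_core {P : Set M} (hP : IsPrimeFilter P) : ofPrime hP ∈ core M := by
  simpa [core] using hP

theorem mem_core_iff : p ∈ core M ↔ DirectedOn (· ≤ ·) {a | p.1 a = true}ᶜ := by
  refine isPrimeFilter_iff.trans ⟨fun h => h.2.2, fun h => ⟨p.2.isPFilter, ⟨⊥, ?_⟩, h⟩⟩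
  exact p.2.bot_notMem

theorem isClopen_setOf (a : M) : IsClopen {p : M.OptimalFilter | p.1 a = true} :=
  (isClopen_discrete {true}).preimage ((continuous_apply a).comp continuous_subtype_val)

/-- Each defining condition constrains only finitely many coordinates, hence is closed. Directedness
of the complement is not visibly of this kind, being existential over all of `M`. -/
theorem isClosed_setOf_isOptimalFilter (M : BDMSP.{u}) :
    IsClosed {p : M → Bool | IsOptimalFilter {a | p a = true}} := by
  have hcl (a : M) : IsClopen {p : M → Bool | p a = true} :=
    (isClopen_discrete {true}).preimage (continuous_apply a)
  have himp {s t : Set (M → Bool)} (hs : IsClopen s) (ht : IsClosed t) :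
      IsClosed {p | p ∈ s → p ∈ t} := by
    simp only [imp_iff_not_or]
    exact hs.compl.isClosed.union ht
  have : {p : M → Bool | IsOptimalFilter {a | p a = true}} =
      (((⋂ (a : M) (b : M) (_ : a ≤ b), {p | p ∈ {p | p a = true} → p ∈ {p | p b = true}}) ∩
        {p | p ⊤ = true}) ∩
      (⋂ (a : M) (b : M), {p | p ∈ {p | p a = true} ∩ {p | p b = true} →
        p ∈ {p | p (a ⊓ b) = true}})) ∩
      ⋂ (S : Finset M) (a : M) (_ : ∀ c ∈ upperBounds (S : Set M), a ≤ c),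
        {p | p ∈ {p | p a = true} → p ∈ ⋃ s ∈ S, {p | p s = true}} := by
    ext p
    simp only [Set.mem_inter_iff, Set.mem_iInter, Set.mem_iUnion, Set.mem_ofPred_eq, exists_prop]
    constructor
    · intro h
      obtain ⟨hup, htop, hinf⟩ := isPFilter_iff.1 h.isPFilter
      exact ⟨⟨⟨fun a b hab ha => hup hab ha, htop⟩, fun a b hab => hinf a hab.1 b hab.2⟩,
        fun S a haS ha => h.exists_mem S a ha haS⟩
    · rintro ⟨⟨⟨hup, htop⟩, hinf⟩, hS⟩
      exact ⟨isPFilter_iff.2 ⟨fun a b hab ha => hup a b hab ha, htop,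
        fun a ha b hb => hinf a b ⟨ha, hb⟩⟩, fun S a ha haS => hS S a haS ha⟩
  rw [this]
  refine ((IsClosed.inter ?_ (hcl ⊤).isClosed).inter ?_).inter ?_
  · exact isClosed_iInter fun a => isClosed_iInter fun b => isClosed_iInter fun _ =>
      himp (hcl a) (hcl b).isClosed
  · exact isClosed_iInter fun a => isClosed_iInter fun b =>
      himp ((hcl a).inter (hcl b)) (hcl _).isClosed
  · exact isClosed_iInter fun S => isClosed_iInter fun a => isClosed_iInter fun _ =>
      himp (hcl a) (isClosed_biUnion_finset fun s _ => (hcl s).isClosed)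

instance : CompactSpace M.OptimalFilter :=
  isCompact_iff_compactSpace.1 (isClosed_setOf_isOptimalFilter M).isCompact

theorem isUpperSet_setOf (a : M) : IsUpperSet {p : M.OptimalFilter | p.1 a = true} :=
  fun _ _ h hp => le_iff.1 h a hp

instance : PriestleySpace M.OptimalFilter where
  priestley {p q} h := by
    rw [le_iff] at h
    push Not at h
    obtain ⟨a, hp, hq⟩ := h
    exact ⟨_, isClopen_setOf a, isUpperSet_setOf a, hp, hq⟩

theorem exists_le_ofPrime {a : M} (ha : p.1 a ≠ true) :
    ∃ (P : Set M) (hP : IsPrimeFilter P), p ≤ ofPrime hP ∧ a ∉ P := by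
  obtain ⟨P, hP, hpP, haP⟩ := exists_isPrimeFilter M.distrib p.2.isPFilter ha
  exact ⟨P, hP, le_iff.2 fun b hb => (ofPrime_apply hP b).2 (hpP hb), haP⟩

theorem isAdmissible_setOf (a : M) :
    IsAdmissible (core M) {p : M.OptimalFilter | p.1 a = true} where
  isClopen := isClopen_setOf a
  isUpperSet := isUpperSet_setOf a
  maximal_mem p hp := by
    -- A point missing `a` extends to a prime filter missing `a`; maximality makes the two equal.
    obtain ⟨P, hP, hpP, haP⟩ := exists_le_ofPrime hp.prop
    rw [hp.eq_of_le (fun h => haP ((ofPrime_apply hP a).1 h)) hpP]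
    exact ofPrime_mem_core hP

/-- The set of optimal filters containing a given element, as an admissible clopen upset. -/
def basic (M : BDMSP.{u}) : InfTopHom M (AdmissibleUpset (core M)) where
  toFun a := ⟨_, isAdmissible_setOf a⟩
  map_inf' a b := by
    refine Subtype.ext (Set.ext fun p => ?_)
    obtain ⟨hup, -, hinf⟩ := isPFilter_iff.1 p.2.isPFilter
    exact ⟨fun h => ⟨hup inf_le_left h, hup inf_le_right h⟩, fun h => hinf a h.1 b h.2⟩
  map_top' := Subtype.ext (Set.eq_univ_of_forall fun p => (isPFilter_iff.1 p.2.isPFilter).2.1)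

theorem basic_le_basic_iff {a b : M} : basic M a ≤ basic M b ↔ a ≤ b := by
  refine ⟨fun h => ?_, fun h => OrderHomClass.mono (basic M) h⟩
  by_contra hab
  obtain ⟨P, hP, ha, hb⟩ := exists_isPrimeFilter_of_not_le M.distrib hab
  exact hb ((ofPrime_apply hP b).1 (h ((ofPrime_apply hP a).2 ha)))

/-- Each `q ∈ U` contains some `b` outside `p`, because `U` is an upset missing `p`. Compactness
leaves finitely many such `b`, and primeness of `p` bounds them by one `c` outside `p`. -/
theorem exists_le_basic {U : AdmissibleUpset (core M)} (hp : p ∈ core M) (hpU : p ∉ U.1) :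
    ∃ c : M, U ≤ basic M c ∧ p ∉ (basic M c).1 := by
  let ι := {b : M // p.1 b ≠ true}
  obtain ⟨T, hT⟩ := U.2.isClopen.isClosed.isCompact.elim_finite_subcover
    (fun b : ι => (basic M b.1).1) (fun b => (isClopen_setOf b.1).isOpen) fun q hq => by
      have hqp : ¬q ≤ p := fun h => hpU (U.2.isUpperSet h hq)
      rw [le_iff] at hqp
      push Not at hqp
      obtain ⟨b, hqb, hpb⟩ := hqp
      exact Set.mem_iUnion.2 ⟨⟨b, hpb⟩, hqb⟩
  obtain ⟨c, hc, hcT⟩ := (mem_core_iff.1 hp).exists_mem_upperBounds ⟨⊥, p.2.bot_notMem⟩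
    (T.finite_toSet.image Subtype.val) (by
      rintro _ ⟨b, -, rfl⟩
      exact b.2)
  refine ⟨c, fun q hq => ?_, hc⟩
  obtain ⟨b, hb, hqb⟩ := Set.mem_iUnion₂.1 (hT hq)
  exact basic_le_basic_iff.2 (hcT ⟨b, hb, rfl⟩) hqb

theorem basic_surjective : Function.Surjective (basic M) := fun U => by
  obtain ⟨T, hT⟩ := exists_finset_inf_le (fun c : {c : M // U ≤ basic M c} => basic M c.1) U
    fun p hp hpU => by
      obtain ⟨c, hUc, hpc⟩ := exists_le_basic hp hpU
      exact ⟨⟨c, hUc⟩, hpc⟩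
  refine ⟨T.inf Subtype.val, le_antisymm ?_ ?_⟩
  · rw [map_finset_inf]
    exact hT
  · rw [map_finset_inf]
    exact Finset.le_inf fun c _ => c.2

/-- A basic neighbourhood of `p` fixes finitely many coordinates. Let `m` be the meet of those in
`p`; as `p` contains none of the others, optimality gives an upper bound `c` of them with `m ≰ c`. A
prime filter containing `m` and missing `c` agrees with `p` on all these coordinates. -/
theorem dense_core (M : BDMSP.{u}) : Dense (core M) := by
  classical
  refine dense_iff_inter_open.2 fun U hU ⟨p, hp⟩ => ?_
  obtain ⟨V, hV, rfl⟩ := isOpen_induced_iff.1 hU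
  obtain ⟨I, v, hv, hvV⟩ := isOpen_pi_iff.1 hV p.1 hp
  have hmem : {a ∈ I | p.1 a = true}.inf id ∈ {a | p.1 a = true} := by
    obtain ⟨-, htop, hinf⟩ := isPFilter_iff.1 p.2.isPFilter
    exact Finset.inf_induction htop hinf fun a ha => (Finset.mem_filter.1 ha).2
  have hS : ¬∃ s ∈ {a ∈ I | p.1 a ≠ true}, s ∈ {a | p.1 a = true} := fun ⟨s, hs, hps⟩ =>
    (Finset.mem_filter.1 hs).2 hps
  obtain ⟨c, hcS, hc⟩ : ∃ c ∈ upperBounds (({a ∈ I | p.1 a ≠ true} : Finset M) : Set M),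
      ¬{a ∈ I | p.1 a = true}.inf id ≤ c := by
    by_contra! h
    exact hS (p.2.exists_mem _ _ hmem h)
  obtain ⟨P, hP, haP, hcP⟩ := exists_isPrimeFilter_of_not_le M.distrib hc
  have hup := (isPFilter_iff.1 hP.isPFilter).1
  refine ⟨ofPrime hP, hvV fun a ha => ?_, ofPrime_mem_core hP⟩
  have : (ofPrime hP).1 a = p.1 a := by
    rw [Bool.eq_iff_iff, ofPrime_apply]
    by_cases hpa : p.1 a = true
    · exact iff_of_true (hup (Finset.inf_le (f := id) (Finset.mem_filter.2 ⟨ha, hpa⟩)) haP) hpa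
    · exact iff_of_false (fun h => hcP (hup (hcS (Finset.mem_filter.2 ⟨ha, hpa⟩)) h)) hpa
  rw [this]
  exact (hv a ha).2

end OptimalFilter

open OptimalFilter

/-- The generalized Priestley space of a bounded distributive meet-semilattice. -/
def spectrum (M : BDMSP.{u}) : GPSP.{u} where
  carrier := M.OptimalFilter
  core := core M
  dense_core := dense_core M
  exists_le_core p := by
    obtain ⟨P, hP, hpP, -⟩ := exists_le_ofPrime p.2.bot_notMem
    exact ⟨_, ofPrime_mem_core hP, hpP⟩
  mem_core_iff p := by
    rw [OptimalFilter.mem_core_iff]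
    constructor
    · rintro h U ⟨hU, hpU⟩ V ⟨hV, hpV⟩
      -- Every admissible set is basic, so directedness of the admissible sets missing `p` is
      -- directedness of the complement of `p`.
      obtain ⟨a, ha⟩ := basic_surjective ⟨U, hU⟩
      obtain ⟨b, hb⟩ := basic_surjective ⟨V, hV⟩
      obtain rfl := congrArg Subtype.val ha
      obtain rfl := congrArg Subtype.val hb
      obtain ⟨c, hc, hac, hbc⟩ := h a hpU b hpV
      exact ⟨_, ⟨(basic M c).2, hc⟩, basic_le_basic_iff.2 hac, basic_le_basic_iff.2 hbc⟩
    · intro h a ha b hb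
      obtain ⟨W, ⟨hW, hpW⟩, haW, hbW⟩ := h _ ⟨(basic M a).2, ha⟩ _ ⟨(basic M b).2, hb⟩
      obtain ⟨c, hc⟩ := basic_surjective ⟨W, hW⟩
      obtain rfl := congrArg Subtype.val hc
      exact ⟨c, hpW, basic_le_basic_iff.1 haW, basic_le_basic_iff.1 hbW⟩
  le_iff p q := ⟨fun h U hU hp => hU.isUpperSet h hp, fun h => OptimalFilter.le_iff.2 fun a ha =>
    h _ (isAdmissible_setOf a) ha⟩

/-- A bounded distributive meet-semilattice is isomorphic to the admissible clopen upsets of its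
generalized Priestley space. -/
noncomputable def spectrumIso (M : BDMSP.{u}) : M ≃o M.spectrum.admissibleUpsets :=
  RelIso.ofSurjective (OrderEmbedding.ofMapLEIff (basic M) fun _ _ => basic_le_basic_iff)
    basic_surjective

end BDMSP

namespace GPSP

instance : admissibleFunctor.{u}.EssSurj where
  mem_essImage M := ⟨Opposite.op M.spectrum, ⟨BDMSP.isoOfOrderIso M.spectrumIso.symm⟩⟩

instance : admissibleFunctor.{u}.IsEquivalence where

end GPSP

theorem mainTheorem7 :
    Nonempty (KAlgFrm.{u} ≌ BDMSP.{u}) ∧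
    Nonempty (KAlgFrm.{u}ᵒᵖ ≌ GPSP.{u}) ∧
    (∀ (M N : BDMSP.{u}) (α : InfTopHom M N),
      LiftsUpperBounds α ↔ ∀ P : Set N, IsPrimeFilter P → IsPrimeFilter (α ⁻¹' P)) ∧
    Nonempty (BDJS.{u}ᵒᵖ ≌ GPSP.{u}) := by
  have e : BDMSP.{u}ᵒᵖ ≌ GPSP.{u} := GPSP.admissibleFunctor.asEquivalence.symm.op.trans
    (opOpEquivalence GPSP)
  exact ⟨⟨KAlgFrm.compactsFunctor.asEquivalence⟩,
    ⟨KAlgFrm.compactsFunctor.asEquivalence.op.trans e⟩,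
    fun _ N α => liftsUpperBounds_iff_isPrimeFilter_preimage N.distrib α,
    ⟨BDJS.dualFunctor.asEquivalence.op.trans e⟩⟩
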